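/- **Theorem (asymptotic performance of MPC for tracking with a scaled offset cost).** *Setting.* Let $X\subset\mathbb R^n$ be bounded, $U\subset\mathbb R^m$ compact, $f:\mathbb R^n\times\mathbb R^m\to\mathbb R^n$ continuous, $\mathcal Z\subseteq X\times U$ compact, $\mathcal Z_{\mathrm r}\subseteq\operatorname{int}\mathcal Z$ closed, and $\mathcal R=\{(x,u)\in\mathcal Z_{\mathrm r}: x=f(x,u)\}$. For $r=(x_r,u_r)$, $\hat r=(x_{\hat r},u_{\hat r})$ put $|r|_{\hat r}=\sqrt{\|x_r-x_{\hat r}\|_2^2+\|u_r-u_{\hat r}\|_2^2}$. Write $x_u(0,x)=x$, $x_u(k+1,x)=f(x_u(k,x),u(k))$. For $K\in\mathbb N_0$, $\mathbb U^K_{\mathbb X}(x)$ is the set of input sequences $u$ of length $K$ with $(x_u(k,x),u(k))\in\mathcal Z$ for $0\le k<K$ and $x_u(K,x)\in X\cap\mathbb X$; $\mathbb U^\infty_{\mathbb X}(x)$ is the set of infinite sequences with $(x_u(k,x),u(k))\in\mathcal Z$ for all $k$ and $\operatorname{dist}(x_u(k,x),\mathbb X)\to0$. Let $\ell:X\times U\times\mathcal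 R\to\mathbb R_{\ge0}$ be the stage cost, $T$ the offset cost (real-valued), $V^{\mathrm f}:X\times\mathcal R\to\mathbb R_{\ge0}$ a continuous terminal cost, $\mathcal X^{\mathrm f}(r)\subseteq X$ ($r\in\mathcal R$) compact terminal sets, $\lambda:\mathbb N_0\to\mathbb R_{\ge0}$ a scaling function, and $\bar\ell(x,r)=\inf\{\ell(x,u,r):u\in U,\ (x,u)\in\mathcal Z\}$. Let $r_{\mathrm d}=(x_{\mathrm d},u_{\mathrm d})\in\mathcal R$ be the unique minimiser of $T$ over $\mathcal R$. *Assumptions.* 1. There are $\alpha_{\mathrm{lo}},\alpha_{\mathrm{up}}\in\mathcal K_\infty$ (continuous, strictly increasing, unbounded functions $[0,\infty)\to[0,\infty)$ vanishing at $0$) with $\alpha_{\mathrm{lo}}(|r|_{r_{\mathrm d}})\le T(r)\le\alpha_{\mathrm{up}}(|r|_{r_{\mathrm d}})$ for all $r\in\mathcal R$. 2. There are $c_1,c_2>0$ with $c_1\|x-x_r\|_2^2\le\bar\ell(x,r)\le c_2\|x-x_r\|_2^2$ for all $(x,u)\in\mathcal Z$, $r\in\mathcal R$. 3. There are $c_3,c_4>0$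 with $\ell(x,u,r_1)\le c_3\,\ell(x,u,r_2)+c_4|r_1|_{r_2}^2$ for all $r_1,r_2\in\mathcal R$, $(x,u)\in\mathcal Z$. 4. There are $c_5,c_6>0$ with $\ell(x,u,r_1)\le\ell(x,u,r_2)+c_5|r_1|_{r_2}^2+c_6|r_1|_{r_2}$, for all $r_1,r_2\in\mathcal R$, $(x,u)\in\mathcal Z$. 5. There are $c_{\mathrm b},c_{\mathrm f}>0$ and $k_{\mathrm f}:X\times\mathcal R\to\mathbb R^m$ such that for all $r\in\mathcal R$: $\{x:\|x-x_r\|_2\le c_{\mathrm b}\}\subseteq\mathcal X^{\mathrm f}(r)$, and for all $x\in\mathcal X^{\mathrm f}(r)$, with $x^+=f(x,k_{\mathrm f}(x,r))$: $x^+\in\mathcal X^{\mathrm f}(r)$, $V^{\mathrm f}(x^+,r)-V^{\mathrm f}(x,r)\le-\ell(x,k_{\mathrm f}(x,r),r)$, $(x,k_{\mathrm f}(x,r))\in\mathcal Z$, $V^{\mathrm f}(x,r)\le c_{\mathrm f}\bar\ell(x,r)$. 6. $\lambda(N)\ge N$ for all $N\in\mathbb N_0$, and $\lambda(0)\ge1$.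 7. There are $c_1^{\mathrm r},c_2^{\mathrm r}>0$ such that for all $r\in\mathcal R$, $\theta\in[0,1]$ there is $\hat r\in\mathcal R$ with $|\hat r|_r\le c_1^{\mathrm r}\theta|r|_{r_{\mathrm d}}$ and $T(\hat r)-T(r)\le-c_2^{\mathrm r}\theta|r|_{r_{\mathrm d}}^2$. *MPC scheme.* For a state $x$ and horizon $N$ consider the problem $$\min_{r\in\mathcal R,\ u\in\mathbb U^N_{\mathcal X^{\mathrm f}(r)}(x)}\ \sum_{k=0}^{N-1}\ell(x_u(k,x),u(k),r)+V^{\mathrm f}(x_u(N,x),r)+\lambda(N)T(r),$$ and let $\mathcal X_N$ be the set of states at which it is feasible. For $N\ge1$ the minimum is taken to be attained at every $x\in\mathcal X_N$; let $(u_N^*(\cdot;x),r_N^*(x))$ be an arbitrary choice of minimiser, $\mu_N(x)=u_N^*(0;x)$, $x_{\mu_N}(0,x)=x$, $x_{\mu_N}(k+1,x)=f(x_{\mu_N}(k,x),\mu_N(x_{\mu_N}(k,x)))$, and $$J_K^{\mathrm d}(x,\mu_N)=\sum_{k=0}^{K-1}\ell\bigl(x_{\mu_N}(k,x),\mu_N(x_{\mu_N}(k,x)),r_{\mathrm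 d}\bigr),\qquad J_\infty^{\mathrm d}(x,u)=\sum_{k=0}^{\infty}\ell\bigl(x_u(k,x),u(k),r_{\mathrm d}\bigr)\in[0,\infty].$$ *Conclusion.* For every $\widetilde N\in\mathbb N_0$ and every $x\in\mathcal X_{\widetilde N}$, the closed loop is well defined for all $N\ge\max(1,\widetilde N)$, that is, $x_{\mu_N}(k,x)\in\mathcal X_N$ for all $k\in\mathbb N_0$; the joint limit of $J_K^{\mathrm d}(x,\mu_N)$ as $N,K\to\infty$ exists in $[0,\infty)$; and $$\lim_{N,K\to\infty}J_K^{\mathrm d}(x,\mu_N)\ \le\ \inf_{u\in\mathbb U^\infty_{\{x_{\mathrm d}\}}(x)}J_\infty^{\mathrm d}(x,u).$$ -/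

import Mathlib

open Filter Topology Set
open scoped ENNReal

/-- States live in `ℝⁿ` and inputs in `ℝᵐ`, with the Euclidean norm. -/
abbrev Euc (n : ℕ) : Type := EuclideanSpace ℝ (Fin n)

/-- State-input pairs, in particular references `r = (x_r, u_r)`. -/
abbrev Ref (n m : ℕ) : Type := Euc n × Euc m

/-- Class `𝒦_∞`: continuous, strictly increasing, unbounded functions on `[0, ∞)` that vanish
at `0` (values at negative arguments are irrelevant). -/
def IsClassKInfty (α : ℝ → ℝ) : Prop :=
  ContinuousOn α (Ici 0) ∧ StrictMonoOn α (Ici 0) ∧ α 0 = 0 ∧ Tendsto α atTop atTop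

/-- The distance `|r|_{r'} = √(‖x_r - x_{r'}‖² + ‖u_r - u_{r'}‖²)` of two references. -/
noncomputable def refDist {n m : ℕ} (r r' : Ref n m) : ℝ :=
  Real.sqrt (dist r.1 r'.1 ^ 2 + dist r.2 r'.2 ^ 2)

/-- The data of an MPC-for-tracking problem with its standing requirements. The functions are total;
only their values on the stated domains matter. -/
structure TrackingProblem (n m : ℕ) where
  /-- dynamics `x(t+1) = f(x(t), u(t))` -/
  f : Euc n → Euc m → Euc n
  /-- state space -/
  X : Set (Euc n)
  /-- input space -/
  U : Set (Euc m)
  /-- pointwise state and input constraints -/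
  Z : Set (Ref n m)
  /-- the set in which admissible references have to lie -/
  Zr : Set (Ref n m)
  /-- stage cost `ℓ(x, u, r)` -/
  stage : Euc n → Euc m → Ref n m → ℝ
  /-- offset cost `T(r)` -/
  T : Ref n m → ℝ
  /-- scaling function `λ(N)` of the offset cost -/
  scale : ℕ → ℝ
  /-- terminal cost `V^f(x, r)` -/
  Vf : Euc n → Ref n m → ℝ
  /-- terminal sets `𝒳^f(r)` -/
  Xf : Ref n m → Set (Euc n)
  f_continuous : Continuous (fun p : Ref n m => f p.1 p.2)
  X_bounded : Bornology.IsBounded X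
  U_compact : IsCompact U
  Z_compact : IsCompact Z
  Z_subset : Z ⊆ X ×ˢ U
  Zr_closed : IsClosed Zr
  Zr_subset : Zr ⊆ interior Z
  stage_nonneg : ∀ x ∈ X, ∀ u ∈ U, ∀ r ∈ Zr, r.1 = f r.1 r.2 → 0 ≤ stage x u r
  scale_nonneg : ∀ N, 0 ≤ scale N

namespace TrackingProblem

variable {n m : ℕ} (P : TrackingProblem n m)

/-- The set `ℛ` of admissible references: the equilibria in `Zr`. -/
def refs : Set (Ref n m) := {r | r ∈ P.Zr ∧ r.1 = P.f r.1 r.2}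

/-- The solution `x_u(k, x)`. -/
def traj (x : Euc n) (u : ℕ → Euc m) : ℕ → Euc n
  | 0 => x
  | k + 1 => P.f (traj x u k) (u k)

/-- `𝕌^K_𝕏(x)` for finite `K`. An input sequence of length `K` is represented by a function on `ℕ`
of which only the first `K` values are used. -/
def admissible (K : ℕ) (S : Set (Euc n)) (x : Euc n) : Set (ℕ → Euc m) :=
  {u | (∀ k < K, (P.traj x u k, u k) ∈ P.Z) ∧ P.traj x u K ∈ P.X ∧ P.traj x u K ∈ S}

/-- `𝕌^∞_𝕏(x)`: infinite admissible input sequences along which the state converges to `𝕏`. -/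
def admissibleInf (S : Set (Euc n)) (x : Euc n) : Set (ℕ → Euc m) :=
  {u | (∀ k, (P.traj x u k, u k) ∈ P.Z) ∧
    Tendsto (fun k => Metric.infEDist (P.traj x u k) S) atTop (𝓝 0)}

/-- `r_d` is the unique minimiser of the offset cost over the admissible references. -/
def IsBestReachable (rd : Ref n m) : Prop :=
  rd ∈ P.refs ∧ ∀ r ∈ P.refs, r ≠ rd → P.T rd < P.T r

/-- `ℓ̄(x, r)`: the stage cost minimised over the inputs `u ∈ U` with `(x, u) ∈ Z`. -/
noncomputable def stageMin (x : Euc n) (r : Ref n m) : ℝ :=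
  sInf ((fun u => P.stage x u r) '' {u | u ∈ P.U ∧ (x, u) ∈ P.Z})

/-- The offset cost is a `𝒦_∞`-indicator of the distance to `r_d`. -/
def OffsetCostIndication (rd : Ref n m) : Prop :=
  ∃ αlo αup : ℝ → ℝ, IsClassKInfty αlo ∧ IsClassKInfty αup ∧
    ∀ r ∈ P.refs, αlo (refDist r rd) ≤ P.T r ∧ P.T r ≤ αup (refDist r rd)

/-- Quadratic lower and upper bound on the minimised stage cost. -/
def StageCostBounds : Prop :=
  ∃ c₁ > 0, ∃ c₂ > 0, ∀ x u, (x, u) ∈ P.Z → ∀ r ∈ P.refs,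
    c₁ * dist x r.1 ^ 2 ≤ P.stageMin x r ∧ P.stageMin x r ≤ c₂ * dist x r.1 ^ 2

/-- First comparison of stage costs with different references. -/
def StageCostDifference : Prop :=
  ∃ c₃ > 0, ∃ c₄ > 0, ∀ r₁ ∈ P.refs, ∀ r₂ ∈ P.refs, ∀ x u, (x, u) ∈ P.Z →
    P.stage x u r₁ ≤ c₃ * P.stage x u r₂ + c₄ * refDist r₁ r₂ ^ 2

/-- Second comparison of stage costs with different references. -/
def StageCostDifferenceLinear : Prop :=
  ∃ c₅ > 0, ∃ c₆ > 0, ∀ r₁ ∈ P.refs, ∀ r₂ ∈ P.refs, ∀ x u, (x, u) ∈ P.Z →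
    P.stage x u r₁ ≤ P.stage x u r₂ + c₅ * refDist r₁ r₂ ^ 2 + c₆ * refDist r₁ r₂

/-- The terminal cost and the terminal sets are suitable terminal ingredients, for some
terminal control law `kf`. -/
def TerminalIngredients : Prop :=
  ContinuousOn (fun p : Euc n × Ref n m => P.Vf p.1 p.2) (P.X ×ˢ P.refs) ∧
  (∀ x ∈ P.X, ∀ r ∈ P.refs, 0 ≤ P.Vf x r) ∧
  (∀ r ∈ P.refs, IsCompact (P.Xf r) ∧ P.Xf r ⊆ P.X) ∧
  ∃ cb > 0, ∃ cf > 0, ∃ kf : Euc n → Ref n m → Euc m, ∀ r ∈ P.refs,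
    Metric.closedBall r.1 cb ⊆ P.Xf r ∧
    ∀ x ∈ P.Xf r,
      P.f x (kf x r) ∈ P.Xf r ∧
      P.Vf (P.f x (kf x r)) r - P.Vf x r ≤ - P.stage x (kf x r) r ∧
      (x, kf x r) ∈ P.Z ∧
      P.Vf x r ≤ cf * P.stageMin x r

/-- The scaling function grows at least linearly. -/
def SuperlinearScaling : Prop :=
  (∀ N : ℕ, (N : ℝ) ≤ P.scale N) ∧ 1 ≤ P.scale 0

/-- From every admissible reference there is a nearby one with a lower offset cost. -/
def BetterCandidate (rd : Ref n m) : Prop :=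
  ∃ c₁ > 0, ∃ c₂ > 0, ∀ r ∈ P.refs, ∀ θ ∈ Icc (0 : ℝ) 1, ∃ r' ∈ P.refs,
    refDist r' r ≤ c₁ * θ * refDist r rd ∧
    P.T r' - P.T r ≤ -(c₂ * θ * refDist r rd ^ 2)

/-- The tracking part `J_N^tc(x, u, r)` of the objective. -/
noncomputable def trackingCost (N : ℕ) (x : Euc n) (u : ℕ → Euc m) (r : Ref n m) : ℝ :=
  (∑ k ∈ Finset.range N, P.stage (P.traj x u k) (u k) r) + P.Vf (P.traj x u N) r

/-- The objective of MPC for tracking with horizon `N` and scaled offset cost. -/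
noncomputable def objective (N : ℕ) (x : Euc n) (u : ℕ → Euc m) (r : Ref n m) : ℝ :=
  P.trackingCost N x u r + P.scale N * P.T r

/-- `(u, r)` is feasible for the MPC problem with horizon `N` at the state `x`. -/
def IsFeasible (N : ℕ) (x : Euc n) (u : ℕ → Euc m) (r : Ref n m) : Prop :=
  r ∈ P.refs ∧ u ∈ P.admissible N (P.Xf r) x

/-- `(u, r)` is an optimal solution of the MPC problem with horizon `N` at the state `x`. -/
def IsOptimal (N : ℕ) (x : Euc n) (u : ℕ → Euc m) (r : Ref n m) : Prop :=
  P.IsFeasible N x u r ∧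
    ∀ u' r', P.IsFeasible N x u' r' → P.objective N x u r ≤ P.objective N x u' r'

/-- `𝒳_N`: the states at which the MPC problem with horizon `N` is feasible. -/
def feasibleSet (N : ℕ) : Set (Euc n) := {x | ∃ u r, P.IsFeasible N x u r}

/-- The closed-loop solution `x_μ(k, x)` under a state feedback `μ`. -/
def closedLoop (μ : Euc n → Euc m) (x : Euc n) : ℕ → Euc n
  | 0 => x
  | k + 1 => P.f (closedLoop μ x k) (μ (closedLoop μ x k))

/-- The closed-loop cost `J_K^d(x, μ)` with respect to the reference `rd`. -/
noncomputable def closedLoopCost (rd : Ref n m) (K : ℕ) (x : Euc n) (μ : Euc n → Euc m) : ℝ :=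
  ∑ k ∈ Finset.range K, P.stage (P.closedLoop μ x k) (μ (P.closedLoop μ x k)) rd

/-- The infinite-horizon cost `J_∞^d(x, u)`, a series of non-negative terms along admissible
inputs, with values in `[0, ∞]`. -/
noncomputable def infiniteCost (rd : Ref n m) (x : Euc n) (u : ℕ → Euc m) : ℝ≥0∞ :=
  ∑' k, ENNReal.ofReal (P.stage (P.traj x u k) (u k) rd)

end TrackingProblem

/-!
The value function `V_N(x)`, the optimal objective with horizon `N`, decreases along the closed
loop by the stage cost at the optimal artificial reference `r*`
(`IsOptimal.objective_step_le`). The proof bounds the closed-loop cost with respect to `r_d` by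
`V_N(x)` up to an error that vanishes as `N → ∞`, and compares `V_N(x)` with infinite-horizon costs.

* Moving the reference step by step to better candidates, and waiting each time until the state
  is close to the current one, steers every feasible state into the terminal set of `r_d`
  (`exists_isFeasible_best`). As `T(r_d) = 0`, the scaling `λ(N)` plays no role for this
  solution, and so `V_N(x) ≤ C` with a `C` that does not depend on `N`.
* A better candidate with `θ = 1` gives `T(r) ≥ c |r|²` with `|r| = |r|_{r_d}`, so
  `N |r*|²` is bounded by a multiple of `V_N`. For large `N` the same candidate, used as a
  competitor, shows that `|r*|²` is bounded by the stage cost, and then that `V_N` itself is bounded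
  by a multiple `κ` of the stage cost, uniformly in `N` (`exists_objective_le_mul_stage`).
* Hence `V_N` decays exponentially along the closed loop, at a rate independent of `N`. The
  references satisfy `|r*| ≤ const · σ ^ k / √N`, so replacing `r*` by `r_d` in the stage cost
  changes the summed cost by an error that tends to zero (`exists_closedLoop_estimates`). The
  exponential decay is essential here: square-summability of `|r*|` would not control the
  linear term of the comparison.
* Truncating an infinite admissible input sequence close to `x_d` gives a feasible solution with
  reference `r_d`, so `limsup V_N(x) ≤ inf J_∞` (`eventually_objective_le`). Conversely the
  closed-loop inputs are themselves admissible for the infinite-horizon problem, and the tails of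
  their costs are uniformly small. So the joint limit exists and equals the infimum.
-/

namespace TrackingProblem

variable {n m : ℕ} {P : TrackingProblem n m}

/-! ### Distances of references and stage costs -/

theorem _root_.refDist_nonneg (r r' : Ref n m) : 0 ≤ refDist r r' := Real.sqrt_nonneg _

theorem _root_.refDist_self (r : Ref n m) : refDist r r = 0 := by simp [refDist]

theorem _root_.dist_fst_le_refDist (r r' : Ref n m) : dist r.1 r'.1 ≤ refDist r r' :=
  Real.le_sqrt_of_sq_le (by nlinarith [sq_nonneg (dist r.2 r'.2)])

theorem exists_refDist_le (P : TrackingProblem n m) (rd : Ref n m) :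
    ∃ D : ℝ, 0 < D ∧ ∀ r ∈ P.refs, refDist r rd ≤ D := by
  obtain ⟨B, hB⟩ := P.Z_compact.isBounded.subset_closedBall rd
  refine ⟨2 * max B 1, by positivity, fun r hr => ?_⟩
  have h : dist r rd ≤ max B 1 :=
    (hB (interior_subset (P.Zr_subset hr.1))).trans (le_max_left _ _)
  have h1 : dist r.1 rd.1 ≤ max B 1 := (le_max_left _ _).trans h
  have h2 : dist r.2 rd.2 ≤ max B 1 := (le_max_right _ _).trans h
  refine Real.sqrt_le_iff.2 ⟨by positivity, ?_⟩
  nlinarith [dist_nonneg (x := r.1) (y := rd.1), dist_nonneg (x := r.2) (y := rd.2)]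

theorem stage_nonneg_of_mem {x : Euc n} {u : Euc m} {r : Ref n m} (h : (x, u) ∈ P.Z)
    (hr : r ∈ P.refs) : 0 ≤ P.stage x u r :=
  P.stage_nonneg x (P.Z_subset h).1 u (P.Z_subset h).2 r hr.1 hr.2

theorem stageMin_le_stage {x : Euc n} {u : Euc m} {r : Ref n m} (h : (x, u) ∈ P.Z)
    (hr : r ∈ P.refs) : P.stageMin x r ≤ P.stage x u r := by
  refine csInf_le ⟨0, ?_⟩ ⟨u, ⟨(P.Z_subset h).2, h⟩, rfl⟩
  rintro _ ⟨v, hv, rfl⟩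
  exact stage_nonneg_of_mem hv.2 hr

theorem OffsetCostIndication.nonneg {rd : Ref n m} (h : P.OffsetCostIndication rd)
    {r : Ref n m} (hr : r ∈ P.refs) : 0 ≤ P.T r := by
  obtain ⟨α, β, hα, -, hT⟩ := h
  have := hα.2.1.monotoneOn self_mem_Ici (refDist_nonneg r rd) (refDist_nonneg r rd)
  rw [hα.2.2.1] at this
  exact this.trans (hT r hr).1

theorem OffsetCostIndication.eq_zero {rd : Ref n m} (h : P.OffsetCostIndication rd)
    (hrd : rd ∈ P.refs) : P.T rd = 0 := by
  refine le_antisymm ?_ (h.nonneg hrd)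
  obtain ⟨α, β, -, hβ, hT⟩ := h
  simpa [refDist_self, hβ.2.2.1] using (hT rd hrd).2

/-! ### Trajectories -/

theorem traj_congr (x : Euc n) {u v : ℕ → Euc m} {K : ℕ} (h : ∀ k < K, u k = v k) :
    ∀ k ≤ K, P.traj x u k = P.traj x v k := by
  intro k
  induction k with
  | zero => intro _; rfl
  | succ k ih =>
    intro hk
    simp only [traj]
    rw [ih (by omega), h k (by omega)]

theorem traj_shift (x : Euc n) (u : ℕ → Euc m) (k : ℕ) :
    P.traj (P.f x (u 0)) (fun i => u (i + 1)) k = P.traj x u (k + 1) := by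
  induction k with
  | zero => rfl
  | succ k ih => simp only [traj] at ih ⊢; rw [ih]

theorem traj_closedLoop (x : Euc n) (μ : Euc n → Euc m) (k : ℕ) :
    P.traj x (fun i => μ (P.closedLoop μ x i)) k = P.closedLoop μ x k := by
  induction k with
  | zero => rfl
  | succ k ih => simp only [traj, closedLoop]; rw [ih]

/-! ### Terminal control law and the shifted candidate -/

/-- `kf` is a terminal control law with constants `cb` and `cf`: the terminal set of `r` contains
the ball of radius `cb` about the state of `r` and is invariant under `kf`, the terminal cost is a
Lyapunov function there, and it is bounded by `cf` times the minimised stage cost. -/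
def IsTerminalLaw (P : TrackingProblem n m) (cb cf : ℝ) (kf : Euc n → Ref n m → Euc m) : Prop :=
  ∀ r ∈ P.refs, P.Xf r ⊆ P.X ∧ (∀ x ∈ P.X, 0 ≤ P.Vf x r) ∧
    Metric.closedBall r.1 cb ⊆ P.Xf r ∧
    ∀ x ∈ P.Xf r,
      P.f x (kf x r) ∈ P.Xf r ∧
      P.Vf (P.f x (kf x r)) r - P.Vf x r ≤ - P.stage x (kf x r) r ∧
      (x, kf x r) ∈ P.Z ∧
      P.Vf x r ≤ cf * P.stageMin x r

/-- The minimised stage cost lies between `c₁` and `c₂` times the squared distance to `r.1`. -/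
def HasStageBounds (P : TrackingProblem n m) (c₁ c₂ : ℝ) : Prop :=
  ∀ x u, (x, u) ∈ P.Z → ∀ r ∈ P.refs,
    c₁ * dist x r.1 ^ 2 ≤ P.stageMin x r ∧ P.stageMin x r ≤ c₂ * dist x r.1 ^ 2

section

variable {cb cf c₁ c₂ : ℝ} {kf : Euc n → Ref n m → Euc m}

theorem HasStageBounds.le_stage (hS : P.HasStageBounds c₁ c₂) {x : Euc n} {u : Euc m}
    {r : Ref n m} (h : (x, u) ∈ P.Z) (hr : r ∈ P.refs) :
    c₁ * dist x r.1 ^ 2 ≤ P.stage x u r :=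
  (hS x u h r hr).1.trans (stageMin_le_stage h hr)

theorem IsTerminalLaw.Vf_le (hL : P.IsTerminalLaw cb cf kf) (hS : P.HasStageBounds c₁ c₂)
    (hcf : 0 < cf) {x : Euc n} {r : Ref n m} (hr : r ∈ P.refs) (hx : dist x r.1 ≤ cb) :
    P.Vf x r ≤ cf * c₂ * dist x r.1 ^ 2 := by
  obtain ⟨-, -, hb, h⟩ := hL r hr
  obtain ⟨-, -, hZ, hV⟩ := h x (hb hx)
  rw [mul_assoc]
  exact hV.trans (mul_le_mul_of_nonneg_left (hS _ _ hZ r hr).2 hcf.le)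

/-- A feasible solution can be prolonged by one step of the terminal control law; the terminal cost
drops by the stage cost that is added. -/
theorem IsFeasible.extend (hL : P.IsTerminalLaw cb cf kf) {N : ℕ} {x : Euc n} {u : ℕ → Euc m}
    {r : Ref n m} (h : P.IsFeasible N x u r) :
    ∃ v, P.IsFeasible (N + 1) x v r ∧ (∀ k < N, v k = u k) ∧
      P.traj x v N = P.traj x u N ∧
      P.trackingCost (N + 1) x v r ≤ P.trackingCost N x u r ∧
      P.Vf (P.traj x v (N + 1)) r ≤ P.Vf (P.traj x u N) r - P.stage (P.traj x v N) (v N) r := by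
  obtain ⟨hr, hZ, hX, hXf⟩ := h
  obtain ⟨hsub, -, -, hl⟩ := hL r hr
  obtain ⟨h1, h2, h3, -⟩ := hl _ hXf
  set v := Function.update u N (kf (P.traj x u N) r) with hv
  have hvu : ∀ k < N, v k = u k := fun k hk => by simp [hv, hk.ne]
  have hvN : v N = kf (P.traj x u N) r := by simp [hv]
  have ht := P.traj_congr x hvu
  have hlast : P.traj x v (N + 1) = P.f (P.traj x u N) (kf (P.traj x u N) r) := by
    simp only [traj]; rw [ht N le_rfl, hvN]
  have hVf : P.Vf (P.traj x v (N + 1)) r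
      ≤ P.Vf (P.traj x u N) r - P.stage (P.traj x v N) (v N) r := by
    rw [hlast, ht N le_rfl, hvN]; linarith
  refine ⟨v, ⟨hr, fun k hk => ?_, hlast ▸ hsub h1, hlast ▸ h1⟩, hvu, ht N le_rfl, ?_, hVf⟩
  · rcases Nat.lt_succ_iff_lt_or_eq.1 hk with hk | rfl
    · rw [ht k hk.le, hvu k hk]; exact hZ k hk
    · rw [ht k le_rfl, hvN]; exact h3
  · unfold trackingCost
    rw [Finset.sum_range_succ]
    have : ∑ k ∈ Finset.range N, P.stage (P.traj x v k) (v k) r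
        = ∑ k ∈ Finset.range N, P.stage (P.traj x u k) (u k) r :=
      Finset.sum_congr rfl fun k hk => by
        rw [ht k (Finset.mem_range.1 hk).le, hvu k (Finset.mem_range.1 hk)]
    linarith

theorem IsFeasible.exists_of_le (hL : P.IsTerminalLaw cb cf kf) {M N : ℕ} (hMN : M ≤ N)
    {x : Euc n} {u : ℕ → Euc m} {r : Ref n m} (h : P.IsFeasible M x u r) :
    ∃ v, P.IsFeasible N x v r ∧ P.trackingCost N x v r ≤ P.trackingCost M x u r := by
  induction N, hMN using Nat.le_induction with
  | base => exact ⟨u, h, le_rfl⟩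
  | succ N _ ih =>
    obtain ⟨v, hv, hc⟩ := ih
    obtain ⟨w, hw, -, -, hc', -⟩ := hv.extend hL
    exact ⟨w, hw, hc'.trans hc⟩

theorem IsTerminalLaw.exists_isFeasible (hL : P.IsTerminalLaw cb cf kf) (N : ℕ) {x : Euc n}
    {r : Ref n m} (hr : r ∈ P.refs) (hx : dist x r.1 ≤ cb) :
    ∃ v, P.IsFeasible N x v r ∧ P.trackingCost N x v r ≤ P.Vf x r := by
  obtain ⟨hsub, -, hb, -⟩ := hL r hr
  have h0 : P.IsFeasible 0 x (fun _ => 0) r :=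
    ⟨hr, fun k hk => absurd hk (Nat.not_lt_zero k), hsub (hb hx), hb hx⟩
  obtain ⟨v, hv, hc⟩ := h0.exists_of_le hL (Nat.zero_le N)
  exact ⟨v, hv, hc.trans (by simp [trackingCost, traj])⟩

/-- The shifted candidate: drop the first input and append one step of the terminal law. -/
theorem IsFeasible.shift (hL : P.IsTerminalLaw cb cf kf) {N : ℕ} (hN : 1 ≤ N) {x : Euc n}
    {u : ℕ → Euc m} {r : Ref n m} (h : P.IsFeasible N x u r) :
    ∃ v, P.IsFeasible N (P.f x (u 0)) v r ∧
      P.trackingCost N (P.f x (u 0)) v r ≤ P.trackingCost N x u r - P.stage x (u 0) r := by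
  obtain ⟨w, ⟨hr, hZ, hX, hXf⟩, hwu, -, hc, -⟩ := h.extend hL
  have h0 : w 0 = u 0 := hwu 0 hN
  have ht : ∀ k, P.traj (P.f x (u 0)) (fun i => w (i + 1)) k = P.traj x w (k + 1) := by
    rw [← h0]; exact P.traj_shift x w
  refine ⟨fun i => w (i + 1), ⟨hr, fun k hk => ?_, ?_, ?_⟩, ?_⟩
  · rw [ht]; exact hZ (k + 1) (by omega)
  · rw [ht]; exact hX
  · rw [ht]; exact hXf
  · unfold trackingCost at hc ⊢
    rw [Finset.sum_range_succ'] at hc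
    simp only [ht]
    simp only [traj, h0] at hc ⊢
    linarith

theorem IsFeasible.initial_mem (hN : 1 ≤ N) {x : Euc n} {u : ℕ → Euc m} {r : Ref n m}
    (h : P.IsFeasible N x u r) : (x, u 0) ∈ P.Z := h.2.1 0 hN

theorem IsFeasible.stage_add_le_objective (hL : P.IsTerminalLaw cb cf kf) {N : ℕ} (hN : 1 ≤ N)
    {x : Euc n} {u : ℕ → Euc m} {r : Ref n m} (h : P.IsFeasible N x u r) :
    P.stage x (u 0) r + P.scale N * P.T r ≤ P.objective N x u r := by
  have h1 : P.stage x (u 0) r ≤ ∑ k ∈ Finset.range N, P.stage (P.traj x u k) (u k) r :=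
    Finset.single_le_sum (f := fun k => P.stage (P.traj x u k) (u k) r)
      (fun k hk => stage_nonneg_of_mem (h.2.1 k (Finset.mem_range.1 hk)) h.1)
      (Finset.mem_range.2 hN)
  have h2 := (hL r h.1).2.1 _ h.2.2.1
  unfold objective trackingCost
  linarith

/-- The value function decreases along the closed loop by the stage cost at the optimal
reference. -/
theorem IsOptimal.objective_step_le (hL : P.IsTerminalLaw cb cf kf) {N : ℕ} (hN : 1 ≤ N)
    {x : Euc n} {u v : ℕ → Euc m} {r s : Ref n m} (h : P.IsOptimal N x u r)
    (h' : P.IsOptimal N (P.f x (u 0)) v s) :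
    P.objective N (P.f x (u 0)) v s ≤ P.objective N x u r - P.stage x (u 0) r := by
  obtain ⟨w, hw, hc⟩ := h.1.shift hL hN
  have := h'.2 w r hw
  unfold objective at this ⊢
  linarith

theorem feasibleSet_mono (hL : P.IsTerminalLaw cb cf kf) {M N : ℕ} (hMN : M ≤ N) :
    P.feasibleSet M ⊆ P.feasibleSet N := by
  rintro x ⟨u, r, h⟩
  obtain ⟨v, hv, -⟩ := h.exists_of_le hL hMN
  exact ⟨v, r, hv⟩

theorem closedLoop_mem_feasibleSet (hL : P.IsTerminalLaw cb cf kf) {N : ℕ} (hN : 1 ≤ N)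
    {u : Euc n → ℕ → Euc m} {r : Euc n → Ref n m}
    (hOpt : ∀ x ∈ P.feasibleSet N, P.IsOptimal N x (u x) (r x)) {x : Euc n}
    (hx : x ∈ P.feasibleSet N) (k : ℕ) :
    P.closedLoop (fun y => u y 0) x k ∈ P.feasibleSet N := by
  induction k with
  | zero => exact hx
  | succ k ih =>
    obtain ⟨v, hv, -⟩ := (hOpt _ ih).1.shift hL hN
    exact ⟨v, _, hv⟩

/-! ### Reaching the terminal set of the best reference -/

/-- Under the terminal control law the state gets arbitrarily close to the reference. As long as
the distance exceeds `δ`, each step lowers the nonnegative terminal cost by at least `c₁ δ²`. -/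
theorem IsFeasible.exists_dist_le (hL : P.IsTerminalLaw cb cf kf) (hS : P.HasStageBounds c₁ c₂)
    (hc₁ : 0 < c₁) {δ : ℝ} (hδ : 0 < δ) {x : Euc n} {r : Ref n m} {M : ℕ} {u : ℕ → Euc m}
    (h : P.IsFeasible M x u r) :
    ∃ M' u', P.IsFeasible M' x u' r ∧ dist (P.traj x u' M') r.1 ≤ δ := by
  have key : ∀ (j : ℕ) (M : ℕ) (u : ℕ → Euc m), P.IsFeasible M x u r →
      P.Vf (P.traj x u M) r ≤ j * (c₁ * δ ^ 2) →
      ∃ M' u', P.IsFeasible M' x u' r ∧ dist (P.traj x u' M') r.1 ≤ δ := by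
    intro j
    induction j with
    | zero =>
      intro M u h hV
      by_contra! hcon
      have hd := hcon M u h
      obtain ⟨v, hv, -, ht, -, hV'⟩ := h.extend hL
      have h0 := (hL r h.1).2.1 _ hv.2.2.1
      have h1 := hS.le_stage (hv.2.1 M (Nat.lt_succ_self M)) h.1
      rw [ht] at h1 hV'
      have h2 : c₁ * δ ^ 2 < c₁ * dist (P.traj x u M) r.1 ^ 2 := by gcongr
      have h3 : 0 < c₁ * δ ^ 2 := by positivity
      simp only [Nat.cast_zero, zero_mul] at hV
      linarith
    | succ j ih =>
      intro M u h hV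
      by_cases hd : dist (P.traj x u M) r.1 ≤ δ
      · exact ⟨M, u, h, hd⟩
      push Not at hd
      obtain ⟨v, hv, -, ht, -, hV'⟩ := h.extend hL
      refine ih (M + 1) v hv ?_
      have h1 := hS.le_stage (hv.2.1 M (Nat.lt_succ_self M)) h.1
      rw [ht] at h1 hV'
      have h2 : c₁ * δ ^ 2 < c₁ * dist (P.traj x u M) r.1 ^ 2 := by gcongr
      push_cast at hV
      linarith
  obtain ⟨j, hj⟩ := exists_nat_ge (P.Vf (P.traj x u M) r / (c₁ * δ ^ 2))
  exact key j M u h ((div_le_iff₀ (by positivity)).1 hj)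

theorem IsFeasible.of_dist_le (hL : P.IsTerminalLaw cb cf kf) {x : Euc n} {u : ℕ → Euc m}
    {r s : Ref n m} {M : ℕ} (h : P.IsFeasible M x u r) (hs : s ∈ P.refs)
    (hd : dist (P.traj x u M) s.1 ≤ cb) : P.IsFeasible M x u s :=
  ⟨hs, h.2.1, h.2.2.1, (hL s hs).2.2.1 hd⟩

/-- Every feasible state can be steered into the terminal set of the best reference. -/
theorem exists_isFeasible_best (hL : P.IsTerminalLaw cb cf kf) (hS : P.HasStageBounds c₁ c₂)
    (hc₁ : 0 < c₁) (hcb : 0 < cb) {rd : Ref n m} (hrd : rd ∈ P.refs)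
    (hOffset : P.OffsetCostIndication rd) (hBetter : P.BetterCandidate rd)
    {M₀ : ℕ} {x : Euc n} (hx : x ∈ P.feasibleSet M₀) :
    ∃ M u, P.IsFeasible M x u rd := by
  obtain ⟨a, ha, b, hb, hB⟩ := hBetter
  obtain ⟨D, hD, hDr⟩ := P.exists_refDist_le rd
  have hcb2 : 0 < cb / 2 := by positivity
  -- With this `θ` the reference moves by at most `cb / 2`.
  set θ : ℝ := min 1 (cb / 2 / (a * D)) with hθ
  have hθ0 : 0 < θ := lt_min one_pos (by positivity)
  have hθD : a * θ * D ≤ cb / 2 := by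
    have : θ * (a * D) ≤ cb / 2 := (le_div_iff₀ (by positivity)).1 (min_le_right _ _)
    linarith
  set η : ℝ := b * θ * (cb / 2) ^ 2 with hη
  have hη0 : 0 < η := by positivity
  -- Induction on the number of moves, each of which lowers the offset cost by at least `η`.
  have key : ∀ (j : ℕ) (r : Ref n m) (M : ℕ) (u : ℕ → Euc m), P.IsFeasible M x u r →
      P.T r < j * η → ∃ M u, P.IsFeasible M x u rd := by
    intro j
    induction j with
    | zero =>
      intro r M u h hT
      have := hOffset.nonneg h.1
      simp only [Nat.cast_zero, zero_mul] at hT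
      linarith
    | succ j ih =>
      intro r M u h hT
      obtain ⟨M', u', h', hd⟩ := h.exists_dist_le hL hS hc₁ hcb2
      by_cases hr : refDist r rd ≤ cb / 2
      · refine ⟨M', u', h'.of_dist_le hL hrd ?_⟩
        have := dist_triangle (P.traj x u' M') r.1 rd.1
        have := dist_fst_le_refDist r rd
        linarith
      push Not at hr
      obtain ⟨s, hs, hs1, hs2⟩ := hB r h.1 θ ⟨hθ0.le, min_le_left _ _⟩
      refine ih s M' u' (h'.of_dist_le hL hs ?_) ?_
      · have h1 := dist_triangle (P.traj x u' M') r.1 s.1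
        have h2 := dist_fst_le_refDist s r
        rw [dist_comm] at h2
        have h3 : a * θ * refDist r rd ≤ a * θ * D := by gcongr; exact hDr r h.1
        linarith
      · have : η ≤ b * θ * refDist r rd ^ 2 := by rw [hη]; gcongr
        push_cast at hT
        linarith
  obtain ⟨u, r, h⟩ := hx
  obtain ⟨j, hj⟩ := exists_nat_gt (P.T r / η)
  exact key j r M₀ u h ((div_lt_iff₀ hη0).1 hj)

/-! ### Bounding the value function by the stage cost -/

/-- For large horizons, wherever the value function is at most `C`, it is bounded by a multiple of
the stage cost, the distance of the optimal reference from `rd` is of order `1 / √N`, and the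
distance of the state from that of `rd` is controlled by the stage cost. -/
theorem exists_objective_le_mul_stage (hL : P.IsTerminalLaw cb cf kf)
    (hS : P.HasStageBounds c₁ c₂) (hc₁ : 0 < c₁) (hc₂ : 0 < c₂) (hcb : 0 < cb) (hcf : 0 < cf)
    {rd : Ref n m} (hrd : rd ∈ P.refs) (hOffset : P.OffsetCostIndication rd)
    (hScale : P.SuperlinearScaling) (hBetter : P.BetterCandidate rd) {C : ℝ} (hC : 0 ≤ C) :
    ∃ κ > 1, ∃ b > 0, ∃ N₁ : ℕ, 1 ≤ N₁ ∧ ∀ N, N₁ ≤ N → ∀ x u r, P.IsOptimal N x u r →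
      P.objective N x u r ≤ C →
      P.objective N x u r ≤ κ * P.stage x (u 0) r ∧
      b * N * refDist r rd ^ 2 ≤ P.objective N x u r ∧
      dist x rd.1 ^ 2 ≤ κ * P.stage x (u 0) r := by
  obtain ⟨a, ha, b, hb, hB⟩ := hBetter
  obtain ⟨N₁, hN₁⟩ := exists_nat_ge
    (4 * (1 + a) ^ 2 * C / (b * cb ^ 2) + (cf * c₂ * (1 + a) ^ 2 + 1) / b)
  refine ⟨1 + 4 / c₁ + 4 * cf * c₂ / c₁ + 4 * C / (c₁ * cb ^ 2), ?_, b, hb, N₁ + 1, by omega, ?_⟩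
  · have h1 : 0 < 4 / c₁ := by positivity
    have h2 : 0 < 4 * cf * c₂ / c₁ := by positivity
    have h3 : 0 ≤ 4 * C / (c₁ * cb ^ 2) := by positivity
    linarith
  intro N hN x u r hopt hVC
  have hN1 : 1 ≤ N := by omega
  have hNr : (N₁ : ℝ) ≤ N := by exact_mod_cast (by omega : N₁ ≤ N)
  have hr := hopt.1.1
  have hZ := hopt.1.initial_mem hN1
  have hNpos : (0 : ℝ) < N := by exact_mod_cast hN1
  have hlam := hScale.1 N
  set V := P.objective N x u r with hV
  set s := P.stage x (u 0) r with hs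
  set D := refDist r rd with hD
  have hs0 : 0 ≤ s := stage_nonneg_of_mem hZ hr
  have hD0 : 0 ≤ D := refDist_nonneg _ _
  have hT0 := hOffset.nonneg hr
  have hVlow : s + P.scale N * P.T r ≤ V := hopt.1.stage_add_le_objective hL hN1
  have hds : c₁ * dist x r.1 ^ 2 ≤ s := hS.le_stage hZ hr
  obtain ⟨q, hq, hq1, hq2⟩ := hB r hr 1 ⟨zero_le_one, le_rfl⟩
  rw [mul_one] at hq1 hq2
  have hTq := hOffset.nonneg hq
  have hTr : b * D ^ 2 ≤ P.T r := by linarith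
  have hVD : b * N * D ^ 2 ≤ V := by
    have : (N : ℝ) * (b * D ^ 2) ≤ P.scale N * P.T r :=
      mul_le_mul hlam hTr (by positivity) (P.scale_nonneg N)
    linarith
  have hp1 : 0 ≤ 4 * (1 + a) ^ 2 * C / (b * cb ^ 2) := by positivity
  have hp2 : 0 < (cf * c₂ * (1 + a) ^ 2 + 1) / b := by positivity
  have hNa : 4 * (1 + a) ^ 2 * C ≤ N * (b * cb ^ 2) :=
    (div_le_iff₀ (by positivity)).1 (by linarith)
  have hNb : cf * c₂ * (1 + a) ^ 2 + 1 ≤ N * b :=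
    (div_le_iff₀ (by positivity)).1 (by linarith)
  have hDcb : (1 + a) * D ≤ cb / 2 := by
    refine abs_le_of_sq_le_sq' (le_of_mul_le_mul_left ?_ (mul_pos hb hNpos)) (by positivity) |>.2
    have : (1 + a) ^ 2 * (b * N * D ^ 2) ≤ (1 + a) ^ 2 * C := by gcongr; exact hVD.trans hVC
    linarith
  have hD2 : D ≤ cb / 2 := (le_mul_of_one_le_left hD0 (by linarith)).trans hDcb
  -- A state closer to `r.1` than `D` is close to the better candidate `q`, whose lower offset cost
  -- contradicts optimality unless `D = 0`.
  have hDs : c₁ * D ^ 2 ≤ s := by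
    by_cases hxD : dist x r.1 ≤ D
    · have hxq : dist x q.1 ≤ (1 + a) * D := by
        have h1 := dist_triangle x r.1 q.1
        have h2 := dist_fst_le_refDist q r
        rw [dist_comm] at h2
        linarith
      obtain ⟨v, hv, hvc⟩ := hL.exists_isFeasible N hq (hxq.trans (by linarith))
      have h1 := hopt.2 v q hv
      have h2 := hL.Vf_le hS hcf hq (hxq.trans (by linarith : (1 + a) * D ≤ cb))
      have h3 : cf * c₂ * dist x q.1 ^ 2 ≤ cf * c₂ * ((1 + a) * D) ^ 2 := by gcongr
      have h4 : P.objective N x v q ≤ cf * c₂ * ((1 + a) * D) ^ 2 + P.scale N * P.T q := by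
        unfold objective; linarith
      have h5 : P.scale N * P.T q ≤ P.scale N * P.T r - P.scale N * (b * D ^ 2) := by
        rw [← mul_sub]
        exact mul_le_mul_of_nonneg_left (by linarith) (P.scale_nonneg N)
      have h6 : (N : ℝ) * (b * D ^ 2) ≤ P.scale N * (b * D ^ 2) := by gcongr
      have h7 : (cf * c₂ * (1 + a) ^ 2 + 1) * D ^ 2 ≤ N * b * D ^ 2 := by gcongr
      have h8 : D ^ 2 = 0 := by
        refine le_antisymm ?_ (sq_nonneg D)
        have : V ≤ P.objective N x v q := h1
        linarith
      rw [h8, mul_zero]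
      exact hs0
    · push Not at hxD
      refine le_trans ?_ hds
      gcongr
  have hdd : dist x rd.1 ^ 2 ≤ 4 / c₁ * s := by
    have h1 := dist_triangle x r.1 rd.1
    have h2 := dist_fst_le_refDist r rd
    have h3 : dist x rd.1 ^ 2 ≤ (dist x r.1 + D) ^ 2 := by gcongr; linarith
    rw [div_mul_eq_mul_div, le_div_iff₀ hc₁]
    nlinarith [sq_nonneg (dist x r.1 - D)]
  have hk1 : 0 ≤ 4 / c₁ * s := by positivity
  have hk2 : 0 ≤ 4 * cf * c₂ / c₁ * s := by positivity
  have hk3 : 0 ≤ 4 * C / (c₁ * cb ^ 2) * s := by positivity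
  refine ⟨?_, hVD, by linarith⟩
  by_cases hx : dist x rd.1 ≤ cb
  · obtain ⟨v, hv, hvc⟩ := hL.exists_isFeasible N hrd hx
    have h1 : V ≤ P.objective N x v rd := hopt.2 v rd hv
    have h2 := hL.Vf_le hS hcf hrd hx
    unfold objective at h1
    rw [hOffset.eq_zero hrd] at h1
    have h3 : cf * c₂ * dist x rd.1 ^ 2 ≤ cf * c₂ * (4 / c₁ * s) := by gcongr
    have h4 : cf * c₂ * (4 / c₁ * s) = 4 * cf * c₂ / c₁ * s := by ring
    linarith
  · push Not at hx
    have h1 := dist_triangle x r.1 rd.1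
    have h2 := dist_fst_le_refDist r rd
    have h3 : cb / 2 ≤ dist x r.1 := by linarith
    have h4 : c₁ * (cb / 2) ^ 2 ≤ c₁ * dist x r.1 ^ 2 := by gcongr
    have h5 : C ≤ 4 * C / (c₁ * cb ^ 2) * s := by
      rw [div_mul_eq_mul_div, le_div_iff₀ (by positivity)]
      nlinarith
    linarith

end

/-! ### Summed estimates along the closed loop -/

/-- If `V` decreases by `s` in each step and is at most `κ s`, then it decays geometrically. -/
theorem le_mul_pow_of_le_mul_decrease {V s : ℕ → ℝ} {κ C : ℝ} (hκ : 1 < κ)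
    (hV : ∀ k, V (k + 1) ≤ V k - s k) (hs : ∀ k, V k ≤ κ * s k) (h0 : V 0 ≤ C) (k : ℕ) :
    V k ≤ C * (1 - 1 / κ) ^ k := by
  have hκ0 : 0 < κ := by linarith
  have hρ : 0 ≤ 1 - 1 / κ := by
    rw [sub_nonneg, div_le_one hκ0]; exact hκ.le
  induction k with
  | zero => simpa using h0
  | succ k ih =>
    have h1 : V k / κ ≤ s k := (div_le_iff₀ hκ0).2 (by linarith [hs k])
    calc V (k + 1) ≤ V k - V k / κ := by linarith [hV k]
      _ = V k * (1 - 1 / κ) := by ring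
      _ ≤ C * (1 - 1 / κ) ^ k * (1 - 1 / κ) := by gcongr
      _ = C * (1 - 1 / κ) ^ (k + 1) := by ring

/-- A telescoping bound with a geometric error term. -/
theorem sum_range_le_add_geometric {V l : ℕ → ℝ} {e σ : ℝ} (he : 0 ≤ e) (hσ0 : 0 ≤ σ)
    (hσ1 : σ < 1) (hl : ∀ k, l k ≤ V k - V (k + 1) + e * σ ^ k) (K j : ℕ) :
    ∑ k ∈ Finset.range (K + j), l k
      ≤ ∑ k ∈ Finset.range K, l k + V K - V (K + j) + e * σ ^ K / (1 - σ) := by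
  have hpos : 0 < 1 - σ := by linarith
  -- The partial geometric sum is kept exact so that the induction closes.
  have key : ∑ k ∈ Finset.range (K + j), l k
      ≤ ∑ k ∈ Finset.range K, l k + V K - V (K + j)
        + (e * σ ^ K / (1 - σ) - e * σ ^ (K + j) / (1 - σ)) := by
    induction j with
    | zero => simp
    | succ j ih =>
      rw [← add_assoc, Finset.sum_range_succ]
      have h1 := hl (K + j)
      have h2 : e * σ ^ (K + j) / (1 - σ) - e * σ ^ (K + j + 1) / (1 - σ) = e * σ ^ (K + j) := by
        field_simp; ring
      linarith
  have : 0 ≤ e * σ ^ (K + j) / (1 - σ) := by positivity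
  linarith

/-- Uniform estimates for the closed loop: up to an error `e N → 0` the closed-loop cost is bounded
by the value function, its tails decay geometrically at a rate independent of `N`, and the state
converges to that of `rd`. -/
theorem exists_closedLoop_estimates {cb cf c₁ c₂ : ℝ} {kf : Euc n → Ref n m → Euc m}
    (hL : P.IsTerminalLaw cb cf kf)
    (hS : P.HasStageBounds c₁ c₂) (hc₁ : 0 < c₁) (hc₂ : 0 < c₂) (hcb : 0 < cb) (hcf : 0 < cf)
    {rd : Ref n m} (hrd : rd ∈ P.refs) (hOffset : P.OffsetCostIndication rd)
    (hDiffLin : P.StageCostDifferenceLinear)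
    (hScale : P.SuperlinearScaling) (hBetter : P.BetterCandidate rd)
    {uOpt : ℕ → Euc n → ℕ → Euc m} {rOpt : ℕ → Euc n → Ref n m}
    (hOpt : ∀ N : ℕ, 1 ≤ N → ∀ x ∈ P.feasibleSet N, P.IsOptimal N x (uOpt N x) (rOpt N x))
    {N₀ : ℕ} {x : Euc n} (hx : x ∈ P.feasibleSet N₀) :
    ∃ (N₁ : ℕ) (σ E : ℝ) (e : ℕ → ℝ), 1 ≤ N₁ ∧ N₀ ≤ N₁ ∧ 0 ≤ σ ∧ σ < 1 ∧
      Tendsto e atTop (𝓝 0) ∧ ∀ N, N₁ ≤ N →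
      (∀ K, P.closedLoopCost rd K x (fun y => uOpt N y 0)
        ≤ P.objective N x (uOpt N x) (rOpt N x) + e N) ∧
      (∀ K j, P.closedLoopCost rd (K + j) x (fun y => uOpt N y 0)
        ≤ P.closedLoopCost rd K x (fun y => uOpt N y 0) + E * σ ^ K) ∧
      Tendsto (P.closedLoop (fun y => uOpt N y 0) x) atTop (𝓝 rd.1) := by
  obtain ⟨M, v, hv⟩ := exists_isFeasible_best hL hS hc₁ hcb hrd hOffset hBetter hx
  obtain ⟨d₁, hd₁, d₂, hd₂, hdiff⟩ := hDiffLin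
  set C := max 0 (P.trackingCost M x v rd) with hC
  have hC0 : 0 ≤ C := le_max_left _ _
  obtain ⟨κ, hκ, b, hb, N₁, hN₁, hmain⟩ := exists_objective_le_mul_stage hL hS hc₁ hc₂ hcb hcf
    hrd hOffset hScale hBetter hC0
  have hκ0 : 0 < κ := by linarith
  set ρ := 1 - 1 / κ with hρ
  have hρ0 : 0 ≤ ρ := by rw [hρ, sub_nonneg, div_le_one hκ0]; exact hκ.le
  have hρ1 : ρ < 1 := by
    have : 0 < 1 / κ := by positivity
    linarith
  set σ := Real.sqrt ρ with hσ
  have hσ0 : 0 ≤ σ := Real.sqrt_nonneg _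
  have hσ1 : σ < 1 := by rw [hσ, Real.sqrt_lt' one_pos]; simpa using hρ1
  have hρσ : ρ = σ ^ 2 := (Real.sq_sqrt hρ0).symm
  have hσpos : 0 < 1 - σ := by linarith
  set B := C / b with hBdef
  have hB0 : 0 ≤ B := by positivity
  -- `ε N * σ ^ k` bounds the change of the `k`-th stage cost when `rd` replaces the optimal
  -- reference.
  set ε : ℕ → ℝ := fun N => d₁ * (B / N) + d₂ * Real.sqrt (B / N) with hε
  have hε0 : ∀ N, 0 ≤ ε N := fun N => by positivity
  have hBN : Tendsto (fun N : ℕ => B / (N : ℝ)) atTop (𝓝 0) :=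
    tendsto_const_div_atTop_nhds_zero_nat B
  have hεlim : Tendsto ε atTop (𝓝 0) := by
    have h1 := (hBN.const_mul d₁).add (((Real.continuous_sqrt.tendsto 0).comp hBN).const_mul d₂)
    simpa [hε, Function.comp_def] using h1
  have hεle : ∀ N : ℕ, 1 ≤ N → ε N ≤ d₁ * B + d₂ * Real.sqrt B := fun N hN => by
    have : B / (N : ℝ) ≤ B := div_le_self hB0 (by exact_mod_cast hN)
    simp only [hε]
    gcongr
  refine ⟨max N₁ (max N₀ M), σ, C + (d₁ * B + d₂ * Real.sqrt B) / (1 - σ),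
    fun N => ε N / (1 - σ), hN₁.trans (le_max_left _ _),
    (le_max_left _ _).trans (le_max_right _ _), hσ0, hσ1, ?_, ?_⟩
  · simpa using hεlim.div_const (1 - σ)
  intro N hN
  have hNN₁ : N₁ ≤ N := (le_max_left _ _).trans hN
  have hNN₀ : N₀ ≤ N := ((le_max_left _ _).trans (le_max_right _ _)).trans hN
  have hNM : M ≤ N := ((le_max_right _ _).trans (le_max_right _ _)).trans hN
  have hN1 : 1 ≤ N := hN₁.trans hNN₁
  have hNpos : (0 : ℝ) < N := by exact_mod_cast hN1
  set μ : Euc n → Euc m := fun y => uOpt N y 0 with hμ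
  set y : ℕ → Euc n := P.closedLoop μ x with hy
  have hfeas : ∀ k, y k ∈ P.feasibleSet N :=
    closedLoop_mem_feasibleSet hL hN1 (hOpt N hN1) (feasibleSet_mono hL hNN₀ hx)
  have hopt := fun k => hOpt N hN1 (y k) (hfeas k)
  set V : ℕ → ℝ := fun k => P.objective N (y k) (uOpt N (y k)) (rOpt N (y k)) with hV
  set s : ℕ → ℝ := fun k => P.stage (y k) (μ (y k)) (rOpt N (y k)) with hs
  have hZ : ∀ k, (y k, μ (y k)) ∈ P.Z := fun k => (hopt k).1.initial_mem hN1
  have hs0 : ∀ k, 0 ≤ s k := fun k => stage_nonneg_of_mem (hZ k) (hopt k).1.1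
  have hVs : ∀ k, V (k + 1) ≤ V k - s k := fun k =>
    (hopt k).objective_step_le hL hN1 (hopt (k + 1))
  have hV0 : ∀ k, s k ≤ V k := fun k => by
    have h1 := (hopt k).1.stage_add_le_objective hL hN1
    have h2 := mul_nonneg (P.scale_nonneg N) (hOffset.nonneg (hopt k).1.1)
    simp only [hV, hs, hμ]
    linarith
  have hVC0 : V 0 ≤ C := by
    obtain ⟨w, hw, hwc⟩ := hv.exists_of_le hL hNM
    have h1 : V 0 ≤ P.objective N x w rd := (hopt 0).2 w rd hw
    unfold objective at h1
    rw [hOffset.eq_zero hrd] at h1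
    have h2 := le_max_right 0 (P.trackingCost M x v rd)
    linarith
  have hVC : ∀ k, V k ≤ C := fun k => by
    induction k with
    | zero => exact hVC0
    | succ k ih => linarith [hVs k, hs0 k]
  have hm := fun k => hmain N hNN₁ (y k) _ _ (hopt k) (hVC k)
  have hdecay : ∀ k, V k ≤ C * ρ ^ k :=
    le_mul_pow_of_le_mul_decrease hκ hVs (fun k => (hm k).1) hVC0
  have hD : ∀ k, refDist (rOpt N (y k)) rd ^ 2 ≤ B / N * (σ ^ k) ^ 2 := fun k => by
    have h1 := (hm k).2.1.trans (hdecay k)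
    rw [hρσ, ← pow_mul, mul_comm 2 k, pow_mul] at h1
    have h2 : B / N * (σ ^ k) ^ 2 = C * (σ ^ k) ^ 2 / (b * N) := by
      rw [hBdef]; field_simp
    rw [h2, le_div_iff₀ (by positivity)]
    linarith
  have hl : ∀ k, P.stage (y k) (μ (y k)) rd ≤ V k - V (k + 1) + ε N * σ ^ k := fun k => by
    have h1 := hdiff rd hrd (rOpt N (y k)) (hopt k).1.1 _ _ (hZ k)
    have hsymm : refDist rd (rOpt N (y k)) = refDist (rOpt N (y k)) rd := by
      simp [refDist, dist_comm]
    rw [hsymm] at h1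
    have hσk : σ ^ k ≤ 1 := pow_le_one₀ hσ0 hσ1.le
    have hσk0 : 0 ≤ σ ^ k := by positivity
    have h2 : refDist (rOpt N (y k)) rd ≤ Real.sqrt (B / N) * σ ^ k := by
      refine abs_le_of_sq_le_sq' ?_ (by positivity) |>.2
      rw [mul_pow, Real.sq_sqrt (by positivity)]
      exact hD k
    have h3 : refDist (rOpt N (y k)) rd ^ 2 ≤ B / N * σ ^ k := by
      refine (hD k).trans ?_
      gcongr
      nlinarith
    have h4 : d₁ * refDist (rOpt N (y k)) rd ^ 2 ≤ d₁ * (B / N * σ ^ k) := by gcongr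
    have h5 : d₂ * refDist (rOpt N (y k)) rd ≤ d₂ * (Real.sqrt (B / N) * σ ^ k) := by gcongr
    have h6 := hVs k
    have h7 : ε N * σ ^ k = d₁ * (B / N * σ ^ k) + d₂ * (Real.sqrt (B / N) * σ ^ k) := by
      simp only [hε]; ring
    have h8 : s k = P.stage (y k) (μ (y k)) (rOpt N (y k)) := rfl
    linarith
  have hsum := sum_range_le_add_geometric (hε0 N) hσ0 hσ1 hl
  have hVnn : ∀ k, 0 ≤ V k := fun k => (hs0 k).trans (hV0 k)
  refine ⟨fun K => ?_, fun K j => ?_, ?_⟩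
  · have h1 := hsum 0 K
    have h2 := hVnn K
    simp only [zero_add, Finset.range_zero, Finset.sum_empty, pow_zero, mul_one] at h1
    show ∑ k ∈ Finset.range K, P.stage (y k) (μ (y k)) rd ≤ V 0 + ε N / (1 - σ)
    linarith
  · have h1 := hsum K j
    have h2 := hVnn (K + j)
    have h3 : V K ≤ C * σ ^ K := by
      refine (hdecay K).trans ?_
      gcongr
      rw [hρσ]; nlinarith
    have h4 : ε N * σ ^ K / (1 - σ) ≤ (d₁ * B + d₂ * Real.sqrt B) / (1 - σ) * σ ^ K := by
      rw [div_mul_eq_mul_div]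
      gcongr
      exact hεle N hN1
    show ∑ k ∈ Finset.range (K + j), P.stage (y k) (μ (y k)) rd
      ≤ ∑ k ∈ Finset.range K, P.stage (y k) (μ (y k)) rd + _
    linarith
  · rw [tendsto_iff_dist_tendsto_zero]
    have h1 : Tendsto (fun k => κ * (C * ρ ^ k)) atTop (𝓝 0) := by
      simpa using ((tendsto_pow_atTop_nhds_zero_of_lt_one hρ0 hρ1).const_mul C).const_mul κ
    have h2 : Tendsto (fun k => dist (y k) rd.1 ^ 2) atTop (𝓝 0) := by
      refine squeeze_zero (fun k => by positivity) (fun k => ?_) h1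
      refine (hm k).2.2.trans ?_
      gcongr
      exact (hV0 k).trans (hdecay k)
    have h3 := (Real.continuous_sqrt.tendsto 0).comp h2
    simpa [Function.comp_def, Real.sqrt_sq dist_nonneg] using h3

/-! ### Comparison with the infinite-horizon cost -/

theorem sum_stage_le_of_infiniteCost_le {rd : Ref n m} (hrd : rd ∈ P.refs) {x : Euc n}
    {u : ℕ → Euc m} (hu : ∀ k, (P.traj x u k, u k) ∈ P.Z) {J : ℝ} (hJ0 : 0 ≤ J)
    (hJ : P.infiniteCost rd x u ≤ ENNReal.ofReal J) (K : ℕ) :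
    ∑ k ∈ Finset.range K, P.stage (P.traj x u k) (u k) rd ≤ J := by
  have h1 : ∑ k ∈ Finset.range K, ENNReal.ofReal (P.stage (P.traj x u k) (u k) rd)
      ≤ ENNReal.ofReal J := (ENNReal.sum_le_tsum _).trans hJ
  rw [← ENNReal.ofReal_sum_of_nonneg fun k _ => stage_nonneg_of_mem (hu k) hrd] at h1
  exact (ENNReal.ofReal_le_ofReal_iff hJ0).1 h1

/-- Truncating an admissible infinite input sequence close to the state of `rd` bounds the value
function for all large horizons by the infinite-horizon cost. -/
theorem eventually_objective_le {cb cf c₁ c₂ : ℝ} {kf : Euc n → Ref n m → Euc m}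
    (hL : P.IsTerminalLaw cb cf kf) (hS : P.HasStageBounds c₁ c₂) (hcb : 0 < cb) (hcf : 0 < cf)
    {rd : Ref n m} (hrd : rd ∈ P.refs) (hT : P.T rd = 0)
    {x : Euc n} {u : ℕ → Euc m} (hu : u ∈ P.admissibleInf {rd.1} x) {J ε : ℝ} (hJ0 : 0 ≤ J)
    (hJ : P.infiniteCost rd x u ≤ ENNReal.ofReal J) (hε : 0 < ε) :
    ∃ N₂ : ℕ, ∀ N, N₂ ≤ N → ∀ v r, P.IsOptimal N x v r → P.objective N x v r ≤ J + ε := by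
  obtain ⟨hZ, hlim⟩ := hu
  have hd : Tendsto (fun k => dist (P.traj x u k) rd.1) atTop (𝓝 0) := by
    rw [← tendsto_iff_dist_tendsto_zero, tendsto_iff_edist_tendsto_0]
    simpa using hlim
  have hd2 : Tendsto (fun k => cf * c₂ * dist (P.traj x u k) rd.1 ^ 2) atTop (𝓝 0) := by
    simpa using (hd.pow 2).const_mul (cf * c₂)
  obtain ⟨M, h1, h2⟩ := ((hd.eventually_le_const hcb).and (hd2.eventually_le_const hε)).exists
  have hfeas : P.IsFeasible M x u rd :=
    ⟨hrd, fun k _ => hZ k, (P.Z_subset (hZ M)).1, (hL rd hrd).2.2.1 h1⟩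
  refine ⟨M, fun N hN v r hv => ?_⟩
  obtain ⟨w, hw, hwc⟩ := hfeas.exists_of_le hL hN
  have h3 := hv.2 w rd hw
  have h4 := sum_stage_le_of_infiniteCost_le hrd hZ hJ0 hJ M
  have h5 := hL.Vf_le hS hcf hrd h1
  have h6 : P.objective N x w rd ≤ P.trackingCost M x u rd := by
    unfold objective; rw [hT]; linarith
  unfold trackingCost at h6
  linarith

theorem infiniteCost_closedLoop_le {rd : Ref n m} (hrd : rd ∈ P.refs) {x : Euc n}
    {μ : Euc n → Euc m} (hZ : ∀ k, (P.closedLoop μ x k, μ (P.closedLoop μ x k)) ∈ P.Z) {B : ℝ}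
    (hB : ∀ K, P.closedLoopCost rd K x μ ≤ B) :
    P.infiniteCost rd x (fun i => μ (P.closedLoop μ x i)) ≤ ENNReal.ofReal B := by
  unfold infiniteCost
  simp only [traj_closedLoop]
  refine ENNReal.tsum_le_of_sum_range_le fun K => ?_
  rw [← ENNReal.ofReal_sum_of_nonneg fun k _ => stage_nonneg_of_mem (hZ k) hrd]
  exact ENNReal.ofReal_le_ofReal (hB K)

end TrackingProblem

theorem mainTheorem2 {n m : ℕ} (P : TrackingProblem n m) (rd : Ref n m)
    (hrd : P.IsBestReachable rd)
    (hOffset : P.OffsetCostIndication rd)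
    (hStage : P.StageCostBounds)
    (hDiff : P.StageCostDifference)
    (hDiffLin : P.StageCostDifferenceLinear)
    (hTerminal : P.TerminalIngredients)
    (hScale : P.SuperlinearScaling)
    (hBetter : P.BetterCandidate rd)
    (uOpt : ℕ → Euc n → ℕ → Euc m) (rOpt : ℕ → Euc n → Ref n m)
    (hOpt : ∀ N : ℕ, 1 ≤ N → ∀ x ∈ P.feasibleSet N, P.IsOptimal N x (uOpt N x) (rOpt N x))
    (N₀ : ℕ) (x : Euc n) (hx : x ∈ P.feasibleSet N₀) :
    (∀ N : ℕ, 1 ≤ N → N₀ ≤ N → ∀ k : ℕ,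
      P.closedLoop (fun y => uOpt N y 0) x k ∈ P.feasibleSet N) ∧
    ∃ L : ℝ, 0 ≤ L ∧
      Tendsto (fun p : ℕ × ℕ => P.closedLoopCost rd p.2 x (fun y => uOpt p.1 y 0))
        (atTop ×ˢ atTop) (𝓝 L) ∧
      ENNReal.ofReal L ≤ ⨅ u ∈ P.admissibleInf {rd.1} x, P.infiniteCost rd x u := by
  have hr := hrd.1
  obtain ⟨c₁, hc₁, c₂, hc₂, hS⟩ := hStage
  have hS : P.HasStageBounds c₁ c₂ := hS
  obtain ⟨-, hVf, hXf, cb, hcb, cf, hcf, kf, hkf⟩ := hTerminal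
  have hL : P.IsTerminalLaw cb cf kf := fun r h =>
    ⟨(hXf r h).2, fun x hx => hVf x hx r h, (hkf r h).1, (hkf r h).2⟩
  have hfeas : ∀ N : ℕ, 1 ≤ N → N₀ ≤ N → ∀ k : ℕ,
      P.closedLoop (fun y => uOpt N y 0) x k ∈ P.feasibleSet N := fun N hN hNN₀ =>
    TrackingProblem.closedLoop_mem_feasibleSet hL hN (hOpt N hN)
      (TrackingProblem.feasibleSet_mono hL hNN₀ hx)
  refine ⟨hfeas, ?_⟩
  obtain ⟨N₁, σ, E, e, hN₁, hN₀₁, hσ0, hσ1, he, hest⟩ :=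
    TrackingProblem.exists_closedLoop_estimates hL hS hc₁ hc₂ hcb hcf hr hOffset hDiffLin hScale
      hBetter hOpt hx
  have hZ : ∀ N, N₁ ≤ N → ∀ k, (P.closedLoop (fun y => uOpt N y 0) x k,
      uOpt N (P.closedLoop (fun y => uOpt N y 0) x k) 0) ∈ P.Z := fun N hN k =>
    (hOpt N (hN₁.trans hN) _ (hfeas N (hN₁.trans hN) (hN₀₁.trans hN) k)).1.initial_mem
      (hN₁.trans hN)
  set I : ℝ≥0∞ := ⨅ u ∈ P.admissibleInf {rd.1} x, P.infiniteCost rd x u with hI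
  -- The closed-loop inputs compete in the infimum, with a geometrically small tail.
  have hIle : ∀ N, N₁ ≤ N → ∀ K,
      I ≤ ENNReal.ofReal (P.closedLoopCost rd K x (fun y => uOpt N y 0) + E * σ ^ K) := by
    intro N hN K
    obtain ⟨-, htail, hconv⟩ := hest N hN
    have hmono : Monotone fun K => P.closedLoopCost rd K x (fun y => uOpt N y 0) :=
      monotone_nat_of_le_succ fun k => by
        unfold TrackingProblem.closedLoopCost
        rw [Finset.sum_range_succ]
        exact le_add_of_nonneg_right (TrackingProblem.stage_nonneg_of_mem (hZ N hN k) hr)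
    refine (iInf₂_le (fun i => uOpt N (P.closedLoop (fun y => uOpt N y 0) x i) 0) ?_).trans
      (TrackingProblem.infiniteCost_closedLoop_le (μ := fun y => uOpt N y 0) hr (hZ N hN)
        fun K' => (hmono (Nat.le_add_left K' K)).trans (htail K K'))
    have ht := P.traj_closedLoop x (fun y => uOpt N y 0)
    refine ⟨fun k => ?_, ?_⟩
    · rw [ht k]; exact hZ N hN k
    · simp only [ht, Metric.infEDist_singleton]
      exact tendsto_iff_edist_tendsto_0.1 hconv
  have hItop : I ≠ ⊤ := ne_top_of_le_ne_top ENNReal.ofReal_ne_top (hIle N₁ le_rfl 0)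
  refine ⟨I.toReal, ENNReal.toReal_nonneg, ?_, (ENNReal.ofReal_toReal hItop).le⟩
  refine tendsto_order.2 ⟨fun a ha => ?_, fun a ha => ?_⟩
  · have hlim : Tendsto (fun K => E * σ ^ K) atTop (𝓝 0) := by
      simpa using (tendsto_pow_atTop_nhds_zero_of_lt_one hσ0 hσ1).const_mul E
    filter_upwards [(eventually_ge_atTop N₁).prod_mk
      (hlim.eventually_lt_const (sub_pos.2 ha))] with p hp
    have h1 := hIle p.1 hp.1 p.2
    have h2 : 0 ≤ P.closedLoopCost rd p.2 x (fun y => uOpt p.1 y 0) :=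
      Finset.sum_nonneg fun k _ => TrackingProblem.stage_nonneg_of_mem (hZ p.1 hp.1 k) hr
    have h3 := ENNReal.toReal_mono ENNReal.ofReal_ne_top h1
    rw [ENNReal.toReal_ofReal'] at h3
    rcases le_max_iff.1 h3 with h3 | h3 <;> linarith [hp.2]
  · set δ := (a - I.toReal) / 3 with hδ
    have hδ0 : 0 < δ := by rw [hδ]; linarith
    have hlt : I < I + ENNReal.ofReal δ :=
      ENNReal.lt_add_right hItop (by simpa using hδ0)
    obtain ⟨u, hu, hcost⟩ : ∃ u ∈ P.admissibleInf {rd.1} x,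
        P.infiniteCost rd x u < I + ENNReal.ofReal δ := by
      simpa [hI, iInf_lt_iff] using hlt
    have hcost' : P.infiniteCost rd x u ≤ ENNReal.ofReal (I.toReal + δ) := by
      rw [ENNReal.ofReal_add ENNReal.toReal_nonneg hδ0.le, ENNReal.ofReal_toReal hItop]
      exact hcost.le
    obtain ⟨N₂, hN₂⟩ := TrackingProblem.eventually_objective_le hL hS hcb hcf hr
      (hOffset.eq_zero hr) hu (add_nonneg ENNReal.toReal_nonneg hδ0.le) hcost' hδ0
    filter_upwards [((eventually_ge_atTop N₁).and ((eventually_ge_atTop N₂).and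
      (he.eventually_lt_const hδ0))).prod_inl atTop] with p hp
    obtain ⟨h1, h2, h3⟩ := hp
    have h4 := (hest p.1 h1).1 p.2
    have h5 := hN₂ p.1 h2 _ _ (hOpt p.1 (hN₁.trans h1) x
      (TrackingProblem.feasibleSet_mono hL (hN₀₁.trans h1) hx))
    linarith
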